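/- Let $d\ge 2$ be an integer and let $\mathbb T^d=(\mathbb R/\mathbb Z)^d$. For $M\in M_d(\mathbb Z)$ with $\det M\neq 0$, let $T_M:\mathbb T^d\to\mathbb T^d$ be the map $x\mapsto Mx \bmod 1$, and for a Borel probability measure $\mu$ on $\mathbb T^d$ let $T_M\mu$ be the image measure, $T_M\mu(C)=\mu(T_M^{-1}C)$ for every Borel set $C\subseteq\mathbb T^d$. Let $\mathcal P_M(\mathbb T^d)$ be the set of Borel probability measures $\mu$ on $\mathbb T^d$ with $T_M\mu=\mu$, endowed with the topology of weak* convergence, and let $\mathrm{Leb}_d$ be the normalised Lebesgue measure on $\mathbb T^d$. A measure is called continuous if every one-point set has measure zero. Let $A,B\in M_d(\mathbb Z)$ with $\det A\neq 0$ and $\det B\neq 0$. Suppose that (a) $A$ is similar over $\mathbb C$ to a diagonal matrix $\mathrm{diag}(\lambda_1,\dots,\lambda_d)$ with $|\lambda_j|\neq 1$ for all $1\le j\le d$; and that at least one of the following holds: (b) $\gcd(\det A,\det B)=1$; (b') $A$ is upper triangular or lower triangular. Then the set $$\bigl\{\mu\in\mathcal P_A(\mathbb T^d)\;:\;\mu \text{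 is continuous and } T_{B^n}\mu \text{ does not converge weak* to } \mathrm{Leb}_d \text{ as } n\to+\infty\bigr\}$$ is residual in $\mathcal P_A(\mathbb T^d)$, i.e. it contains a countable intersection of dense open subsets of $\mathcal P_A(\mathbb T^d)$ (equivalently, since this space is compact and metrizable, a dense $G_\delta$ subset). -/

import Mathlib

open MeasureTheory Filter Topology

namespace ToralDynamics

/-- The endomorphism `x ↦ A x mod 1` of the torus `𝕋^d = (ℝ/ℤ)^d` given by an integer matrix `A`. -/
def toralMap {d : ℕ} (A : Matrix (Fin d) (Fin d) ℤ) (x : UnitAddTorus (Fin d)) :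
    UnitAddTorus (Fin d) :=
  fun i => ∑ j, A i j • x j

theorem continuous_toralMap {d : ℕ} (A : Matrix (Fin d) (Fin d) ℤ) :
    Continuous (toralMap A) :=
  continuous_pi fun i => continuous_finsetSum _ fun j _ => (continuous_apply j).zsmul (A i j)

/-- The image (push-forward) of a Borel probability measure on the torus under `T_A`. -/
noncomputable def pushforward {d : ℕ} (A : Matrix (Fin d) (Fin d) ℤ)
    (μ : ProbabilityMeasure (UnitAddTorus (Fin d))) :
    ProbabilityMeasure (UnitAddTorus (Fin d)) :=
  μ.map (continuous_toralMap A).measurable.aemeasurable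

/-- The set of `T_A`-invariant Borel probability measures on the torus; as a subtype of
`ProbabilityMeasure` it carries the topology of weak-* convergence. -/
def invariantMeasures {d : ℕ} (A : Matrix (Fin d) (Fin d) ℤ) :
    Set (ProbabilityMeasure (UnitAddTorus (Fin d))) :=
  {μ | pushforward A μ = μ}

theorem isProbabilityMeasure_volume (d : ℕ) :
    IsProbabilityMeasure (volume : Measure (UnitAddTorus (Fin d))) :=
  ⟨by simp [volume_pi, Measure.pi_univ]⟩

/-- The normalised Lebesgue measure on the torus. -/
noncomputable def lebesgue (d : ℕ) : ProbabilityMeasure (UnitAddTorus (Fin d)) :=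
  ⟨volume, isProbabilityMeasure_volume d⟩

end ToralDynamics

/-! This is a Baire category argument. A measure carried by the `m`-torsion points, with `m` coprime
to `det B`, is fixed by infinitely many powers of `T_B`, because `B` has finite order modulo `m`. If
such measures are dense in the space of invariant measures, a generic `μ` is a limit of its own
images under `T_{B^n}` along some `n → ∞`. As a generic `μ` also differs from Lebesgue measure, its
images cannot converge to it. If the dense measures can moreover be given arbitrarily small atoms, a
generic `μ` is continuous.

Density (`dense_invariantMeasures_torsion`) rests on two facts.

Arithmetic: `det (A ^ n - 1)` is always a multiple of `a = det (A - 1)`, so it may share primes with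
`det B`. But `A` has an idempotent power modulo `a * q`, so along an arithmetic progression of `n`
the cofactor `m = det (A ^ n - 1) / a` is coprime to `q` (`exists_det_pow_sub_one_eq`). Points `y`
with `(A ^ n - 1) y ∈ a ℤ^d` are fixed by `A ^ n` and killed by `m`.

Hyperbolicity: the total length of the orbit segment `w, A w, …, A ^ (n - 1) w` is at most `C ‖(A ^
n - 1) w‖` with `C` independent of `n` (`exists_sum_norm_pow_mulVec_le`). Rounding `(A ^ n - 1) x`
to `a ℤ^d` costs a bounded error, so the orbit of `x` is shadowed up to `O(1 / n)` on average. Using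
`K` different roundings gives `K` distinct shadowing points, hence atoms of mass at most `1 / K`. -/

namespace ToralDynamics

open Matrix Finset
open scoped ENNReal NNReal

/-! ### Hyperbolic orbit-length estimate -/

/-- The one-dimensional case: the geometric sum of `‖z‖ ^ l` times `|‖z‖ - 1|` is `|‖z‖ ^ n - 1| ≤
‖z ^ n - 1‖`. Contracting and expanding eigenvalues are treated alike. -/
theorem sum_pow_div_norm_pow_sub_one_le (z : ℂ) (hz : ‖z‖ ≠ 1) (n : ℕ) (a b : ℂ)
    (h : (z ^ n - 1) * a = b) :
    ∑ l ∈ range n, ‖z ^ l * a‖ ≤ |‖z‖ - 1|⁻¹ * ‖b‖ := by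
  have hpos : 0 < |‖z‖ - 1| := abs_pos.2 (sub_ne_zero.2 hz)
  have hgeom : |‖z‖ - 1| * ∑ l ∈ range n, ‖z‖ ^ l ≤ ‖z ^ n - 1‖ := by
    calc |‖z‖ - 1| * ∑ l ∈ range n, ‖z‖ ^ l
        = |(∑ l ∈ range n, ‖z‖ ^ l) * (‖z‖ - 1)| := by
          rw [abs_mul, mul_comm,
            abs_of_nonneg (a := ∑ l ∈ range n, ‖z‖ ^ l) (Finset.sum_nonneg fun _ _ => by positivity)]
      _ = |‖z ^ n‖ - ‖(1 : ℂ)‖| := by rw [geom_sum_mul]; simp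
      _ ≤ ‖z ^ n - 1‖ := abs_norm_sub_norm_le _ _
  rw [inv_mul_eq_div, le_div_iff₀ hpos, ← h, norm_mul]
  calc (∑ l ∈ range n, ‖z ^ l * a‖) * |‖z‖ - 1|
      = (|‖z‖ - 1| * ∑ l ∈ range n, ‖z‖ ^ l) * ‖a‖ := by
        simp only [norm_mul, norm_pow, ← Finset.sum_mul]; ring
    _ ≤ _ := by gcongr

/-- The orbit of `w` under a hyperbolic diagonalizable matrix has total length controlled
by `A ^ n w - w`, uniformly in `n`. -/
theorem exists_sum_norm_pow_mulVec_le {d : ℕ} (A : Matrix (Fin d) (Fin d) ℤ)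
    (hdiag : ∃ (P : Matrix.GeneralLinearGroup (Fin d) ℂ) (eig : Fin d → ℂ),
      (∀ j, ‖eig j‖ ≠ 1) ∧
      A.map (Int.cast : ℤ → ℂ) =
        (P : Matrix (Fin d) (Fin d) ℂ) * Matrix.diagonal eig *
          ((P⁻¹ : Matrix.GeneralLinearGroup (Fin d) ℂ) : Matrix (Fin d) (Fin d) ℂ)) :
    ∃ C : ℝ, 0 ≤ C ∧ ∀ (n : ℕ) (w : Fin d → ℝ),
      ∑ l ∈ range n, ‖(A.map (Int.cast : ℤ → ℝ)) ^ l *ᵥ w‖ ≤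
        C * ‖((A.map (Int.cast : ℤ → ℝ)) ^ n - 1) *ᵥ w‖ := by
  obtain ⟨P, eig, heig, hA⟩ := hdiag
  set Q : Matrix (Fin d) (Fin d) ℂ := ((P⁻¹ : Matrix.GeneralLinearGroup (Fin d) ℂ) :
    Matrix (Fin d) (Fin d) ℂ) with hQ
  set R : Matrix (Fin d) (Fin d) ℂ := (P : Matrix (Fin d) (Fin d) ℂ) with hR
  have hQP : Q * R = 1 := by simp [hQ, hR]
  have hPQ : R * Q = 1 := by simp [hQ, hR]
  set AR := A.map (Int.cast : ℤ → ℝ) with hAR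
  have hmap : AR.map (algebraMap ℝ ℂ) = A.map (Int.cast : ℤ → ℂ) := by
    ext i j; simp [hAR]
  have hQA : ∀ l : ℕ, Q * (A.map (Int.cast : ℤ → ℂ)) ^ l = diagonal (fun j => eig j ^ l) * Q := by
    intro l
    induction l with
    | zero => simp
    | succ l ih =>
      rw [pow_succ, ← mul_assoc, ih, hA]
      have : diagonal (fun j => eig j ^ (l + 1)) = diagonal (fun j => eig j ^ l) * diagonal eig := by
        simp [diagonal_mul_diagonal, pow_succ]
      rw [this]
      simp only [mul_assoc]
      rw [← mul_assoc Q R, hQP, one_mul]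
  have hcast : ∀ (l : ℕ) (w : Fin d → ℝ), (fun i => (((AR ^ l) *ᵥ w) i : ℂ)) =
      (A.map (Int.cast : ℤ → ℂ)) ^ l *ᵥ (fun i => (w i : ℂ)) := by
    intro l w
    rw [← hmap, ← Matrix.map_pow]
    ext i
    exact (algebraMap ℝ ℂ).map_mulVec (AR ^ l) w i
  have hcoord : ∀ (l : ℕ) (w : Fin d → ℝ) (j : Fin d),
      (Q *ᵥ (fun i => (((AR ^ l) *ᵥ w) i : ℂ))) j =
        eig j ^ l * (Q *ᵥ (fun i => (w i : ℂ))) j := by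
    intro l w j
    rw [hcast, mulVec_mulVec, hQA, ← mulVec_mulVec, mulVec_diagonal]
  -- The row sum of `Q` bounds the `j`-th eigencoordinate of a vector by its sup norm; the other
  -- factor is the scalar estimate.
  set c : Fin d → ℝ := fun j => |‖eig j‖ - 1|⁻¹ * ∑ k, ‖Q j k‖ with hc
  have hbound : ∀ (n : ℕ) (w : Fin d → ℝ) (j : Fin d),
      ∑ l ∈ range n, ‖(Q *ᵥ (fun i => (((AR ^ l) *ᵥ w) i : ℂ))) j‖ ≤
        c j * ‖(AR ^ n - 1) *ᵥ w‖ := by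
    intro n w j
    simp only [hcoord]
    refine (sum_pow_div_norm_pow_sub_one_le (eig j) (heig j) n _
      ((Q *ᵥ (fun i => (((AR ^ n - 1) *ᵥ w) i : ℂ))) j) ?_).trans ?_
    · rw [sub_mul, ← hcoord, one_mul, sub_mulVec, one_mulVec]
      have : (fun i => (((AR ^ n *ᵥ w - w) i : ℝ) : ℂ)) =
        (fun i => (((AR ^ n) *ᵥ w) i : ℂ)) - fun i => (w i : ℂ) := by ext i; simp
      rw [this, mulVec_sub]; rfl
    · rw [hc, mul_assoc]
      gcongr
      rw [mulVec, dotProduct, Finset.sum_mul]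
      refine (norm_sum_le _ _).trans (Finset.sum_le_sum fun k _ => ?_)
      rw [norm_mul, Complex.norm_real]
      gcongr
      exact norm_le_pi_norm _ k
  have hc0 : ∀ j, 0 ≤ c j := fun j => by positivity
  refine ⟨∑ i, ∑ j, ‖R i j‖ * c j,
    Finset.sum_nonneg fun i _ => Finset.sum_nonneg fun j _ => mul_nonneg (norm_nonneg _) (hc0 j),
    fun n w => ?_⟩
  have hpt : ∀ (v : Fin d → ℝ), ‖v‖ ≤ ∑ i, ∑ j, ‖R i j‖ * ‖(Q *ᵥ (fun i => (v i : ℂ))) j‖ := by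
    intro v
    have hi : ∀ i, ‖v i‖ ≤ ∑ j, ‖R i j‖ * ‖(Q *ᵥ (fun i => (v i : ℂ))) j‖ := by
      intro i
      have : (v i : ℂ) = (R *ᵥ (Q *ᵥ (fun i => (v i : ℂ)))) i := by
        rw [mulVec_mulVec, hPQ, one_mulVec]
      rw [← Complex.norm_real, this, mulVec, dotProduct]
      refine (norm_sum_le _ _).trans (Finset.sum_le_sum fun k _ => (norm_mul _ _).le)
    have hn : ∀ i, 0 ≤ ∑ j, ‖R i j‖ * ‖(Q *ᵥ (fun i => (v i : ℂ))) j‖ := fun i => by positivity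
    rw [pi_norm_le_iff_of_nonneg (Finset.sum_nonneg fun i _ => hn i)]
    exact fun i => (hi i).trans (Finset.single_le_sum (fun i _ => hn i) (mem_univ i))
  calc ∑ l ∈ range n, ‖AR ^ l *ᵥ w‖
      ≤ ∑ l ∈ range n, ∑ i, ∑ j, ‖R i j‖ * ‖(Q *ᵥ (fun i => ((AR ^ l *ᵥ w) i : ℂ))) j‖ :=
        Finset.sum_le_sum fun l _ => hpt _
    _ = ∑ i, ∑ j, ‖R i j‖ * ∑ l ∈ range n, ‖(Q *ᵥ (fun i => ((AR ^ l *ᵥ w) i : ℂ))) j‖ := by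
        rw [Finset.sum_comm]
        refine Finset.sum_congr rfl fun i _ => ?_
        rw [Finset.sum_comm]
        simp only [Finset.mul_sum]
    _ ≤ ∑ i, ∑ j, ‖R i j‖ * (c j * ‖(AR ^ n - 1) *ᵥ w‖) := by
        gcongr with i _ j _
        exact hbound n w j
    _ = _ := by simp only [Finset.sum_mul, mul_assoc]

/-! ### Arithmetic of `det (A ^ n - 1)` and of powers of `B` -/

theorem exists_isIdempotentElem_pow {M : Type*} [Monoid M] [Finite M] (x : M) :
    ∃ T : ℕ, 0 < T ∧ IsIdempotentElem (x ^ T) := by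
  obtain ⟨i, j, hne, hij⟩ := Finite.exists_ne_map_eq_of_infinite (fun n : ℕ => x ^ n)
  wlog hlt : i < j generalizing i j
  · exact this j i hne.symm hij.symm (by omega)
  obtain ⟨p, hp, rfl⟩ : ∃ p, 0 < p ∧ j = i + p := ⟨j - i, by omega, by omega⟩
  have hper : ∀ k, i ≤ k → ∀ t, x ^ (k + t * p) = x ^ k := by
    intro k hk t
    induction t with
    | zero => simp
    | succ t ih =>
      obtain ⟨s, rfl⟩ := Nat.exists_eq_add_of_le hk
      rw [← ih, show i + s + (t + 1) * p = (i + p) + (s + t * p) by ring, pow_add, ← hij, ← pow_add]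
      congr 1; ring
  -- Powers have period `p` from `i` on, so any positive multiple of `p` that is at least `i`
  -- serves.
  refine ⟨(i + 1) * p, by positivity, ?_⟩
  rw [IsIdempotentElem, ← pow_add]
  exact hper _ (by nlinarith) _

/-- If `A ^ T` is idempotent, then `det (A - 1)` and `det (A ^ (1 + t * T) - 1)` are associated. -/
theorem exists_isUnit_det_mul {R : Type*} [CommRing R] {d : ℕ} (A : Matrix (Fin d) (Fin d) R)
    {T : ℕ} (hT : 0 < T) (hE : IsIdempotentElem (A ^ T)) (t : ℕ) (ht : 0 < t) :
    ∃ u : R, IsUnit u ∧ (A - 1).det = (A ^ (1 + t * T) - 1).det * u := by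
  set E := A ^ T with hEdef
  have hEt : A ^ (t * T) = E := by
    rw [mul_comm, pow_mul, ← hEdef]
    exact hE.pow_eq ht.ne'
  have hcomm : A * E = E * A := by rw [hEdef, ← pow_succ, ← pow_succ']
  have hEE : E * E = E := hE
  -- Since `A ^ (1 + t * T) = A * E`, the identity is the factorization `A - 1 = (A * E - 1) * (1 -
  -- (1 - E) * A)`. Here `(1 - E) * A` is nilpotent: its `T`-th power is `(1 - E) * E = 0`.
  refine ⟨(1 - (1 - E) * A).det, ?_, ?_⟩
  · rw [← Matrix.isUnit_iff_isUnit_det]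
    refine IsNilpotent.isUnit_one_sub ⟨T, ?_⟩
    have hc : Commute (1 - E) A := by
      change (1 - E) * A = A * (1 - E)
      rw [sub_mul, mul_sub, hcomm, one_mul, mul_one]
    rw [hc.mul_pow, hE.one_sub.pow_eq hT.ne', ← hEdef, sub_mul, one_mul, hEE, sub_self]
  · rw [← det_mul, pow_add, pow_one, hEt]
    congr 1
    have h1 : A * E * (E * A) = A * E * A := by rw [← mul_assoc, mul_assoc A E E, hEE]
    simp only [sub_mul, mul_sub, one_mul, mul_one, h1]
    rw [hcomm]
    abel

/-- Along an arithmetic progression of exponents `n`, the integer `det (A ^ n - 1)` is a fixed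
number times an integer coprime to `q`. -/
theorem exists_det_pow_sub_one_eq {d : ℕ} (A : Matrix (Fin d) (Fin d) ℤ)
    (hA : (A - 1).det ≠ 0) (q : ℤ) (hq : q ≠ 0) :
    ∃ T : ℕ, 0 < T ∧ ∀ t : ℕ, 0 < t →
      ∃ m : ℤ, IsCoprime m q ∧ (A ^ (1 + t * T) - 1).det = (A - 1).det * m := by
  set a := (A - 1).det with ha
  -- The modulus is `a * q` rather than `q`: a congruence `det ≡ a * s` modulo `a * q` can be
  -- divided by `a`, leaving a cofactor congruent to the unit `s` modulo `q`.
  set N : ℕ := (a * q).natAbs with hN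
  have : NeZero N := ⟨by simp [hN, hA, hq]⟩
  let f : ℤ →+* ZMod N := Int.castRingHom (ZMod N)
  obtain ⟨T, hT, hE⟩ := exists_isIdempotentElem_pow (f.mapMatrix A)
  refine ⟨T, hT, fun t ht => ?_⟩
  obtain ⟨u, hu, h⟩ := exists_isUnit_det_mul (f.mapMatrix A) hT hE t ht
  have hdet : ∀ n : ℕ, ((f.mapMatrix A) ^ n - 1).det = ((A ^ n - 1).det : ZMod N) := by
    intro n
    rw [← map_pow, ← map_one f.mapMatrix, ← map_sub, ← RingHom.map_det]; rfl
  have h1 := hdet 1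
  simp only [pow_one] at h1
  rw [h1, hdet] at h
  obtain ⟨v, rfl⟩ := hu
  have h2 : ((A ^ (1 + t * T) - 1).det : ZMod N) = (a : ZMod N) * ((v⁻¹ : (ZMod N)ˣ) : ZMod N) := by
    rw [ha, h, mul_assoc]; simp
  obtain ⟨s, hs⟩ := ZMod.intCast_surjective ((v⁻¹ : (ZMod N)ˣ) : ZMod N)
  obtain ⟨s', hs'⟩ := ZMod.intCast_surjective ((v : (ZMod N)ˣ) : ZMod N)
  have hdvd : ∀ z : ℤ, (z : ZMod N) = 0 → a * q ∣ z := by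
    intro z hz
    rw [ZMod.intCast_zmod_eq_zero_iff_dvd] at hz
    exact Int.natAbs_dvd.1 hz
  rw [← hs] at h2
  obtain ⟨k, hk⟩ := hdvd ((A ^ (1 + t * T) - 1).det - a * s) (by
    rw [Int.cast_sub, Int.cast_mul, h2, sub_self])
  obtain ⟨k', hk'⟩ := hdvd (s * s' - 1) (by push_cast; rw [hs, hs']; simp)
  refine ⟨s + q * k, ?_, by linear_combination hk⟩
  have : IsCoprime s q := ⟨s', -(a * k'), by linear_combination hk'⟩
  exact this.add_mul_left_left k

/-- `B` is invertible modulo `m`, and `r` is its order in the finite group of invertible matrices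
over `ZMod m.natAbs`. -/
theorem exists_pow_eq_one_add_smul {d : ℕ} (B : Matrix (Fin d) (Fin d) ℤ) (m : ℤ) (hm : m ≠ 0)
    (h : IsCoprime m B.det) :
    ∃ r : ℕ, 0 < r ∧ ∀ t : ℕ, ∃ D : Matrix (Fin d) (Fin d) ℤ, B ^ (t * r) = 1 + m • D := by
  have : NeZero m.natAbs := ⟨by simpa using hm⟩
  let f : ℤ →+* ZMod m.natAbs := Int.castRingHom _
  have hfm : f m = 0 := by
    simp [f, ZMod.intCast_zmod_eq_zero_iff_dvd]
  have hunit : IsUnit (f.mapMatrix B) := by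
    rw [Matrix.isUnit_iff_isUnit_det, ← RingHom.map_det]
    obtain ⟨x, y, hxy⟩ := h
    have := congrArg f hxy
    rw [map_add, map_mul, map_mul, hfm, mul_zero, zero_add, map_one] at this
    exact .of_mul_eq_one_right _ this
  obtain ⟨U, hU⟩ := hunit
  refine ⟨orderOf U, orderOf_pos U, fun t => ?_⟩
  have h1 : f.mapMatrix (B ^ (t * orderOf U)) = 1 := by
    rw [map_pow, ← hU, ← Units.val_pow_eq_pow_val, mul_comm, pow_mul, pow_orderOf_eq_one, one_pow,
      Units.val_one]
  have h2 : ∀ i j, m ∣ (B ^ (t * orderOf U) - 1) i j := by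
    intro i j
    have h3 : f ((B ^ (t * orderOf U) - 1) i j) = 0 := by
      have h4 : f.mapMatrix (B ^ (t * orderOf U) - 1) = 0 := by rw [map_sub, h1, map_one, sub_self]
      exact congrFun (congrFun h4 i) j
    exact Int.natAbs_dvd.1 ((ZMod.intCast_zmod_eq_zero_iff_dvd _ _).1 h3)
  choose D hD using h2
  refine ⟨Matrix.of D, ?_⟩
  rw [← sub_eq_iff_eq_add']
  ext i j
  simpa using hD i j

/-! ### Covering map and algebra of toral endomorphisms -/

/-- The covering map `ℝ^d → 𝕋^d`. -/
def proj {d : ℕ} (v : Fin d → ℝ) : UnitAddTorus (Fin d) := fun i => (v i : UnitAddCircle)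

theorem measurable_proj {d : ℕ} : Measurable (proj (d := d)) :=
  measurable_pi_lambda _ fun i => AddCircle.measurable_mk'.comp (measurable_pi_apply i)

theorem proj_sub {d : ℕ} (v w : Fin d → ℝ) : proj (v - w) = proj v - proj w := rfl

theorem proj_eq_zero_iff {d : ℕ} (v : Fin d → ℝ) :
    proj v = 0 ↔ ∃ z : Fin d → ℤ, v = fun i => (z i : ℝ) := by
  constructor
  · intro h
    have h' : ∀ i, ∃ n : ℤ, (n : ℝ) = v i := by
      intro i
      obtain ⟨n, hn⟩ := (AddCircle.coe_eq_zero_iff (1 : ℝ)).1 (congrFun h i)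
      exact ⟨n, by simpa using hn⟩
    choose z hz using h'
    exact ⟨z, funext fun i => (hz i).symm⟩
  · rintro ⟨z, rfl⟩
    ext i
    exact (AddCircle.coe_eq_zero_iff (1 : ℝ)).2 ⟨z i, by simp⟩

theorem dist_proj_le {d : ℕ} (v w : Fin d → ℝ) : dist (proj v) (proj w) ≤ ‖v - w‖ := by
  rw [dist_pi_le_iff (norm_nonneg _)]
  intro i
  refine le_trans ?_ (norm_le_pi_norm (v - w) i)
  rw [dist_eq_norm]
  exact QuotientAddGroup.norm_mk_le_norm

theorem toralMap_proj {d : ℕ} (M : Matrix (Fin d) (Fin d) ℤ) (v : Fin d → ℝ) :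
    toralMap M (proj v) = proj (M.map (Int.cast : ℤ → ℝ) *ᵥ v) := by
  ext i
  simp only [toralMap, proj, mulVec, dotProduct, map_apply]
  rw [show ((∑ j, (M i j : ℝ) * v j : ℝ) : UnitAddCircle) = ∑ j, (((M i j : ℝ) * v j : ℝ) :
    UnitAddCircle) from map_sum (QuotientAddGroup.mk' (AddSubgroup.zmultiples (1 : ℝ))) _ _]
  refine Finset.sum_congr rfl fun j _ => ?_
  rw [← zsmul_eq_mul, AddCircle.coe_zsmul]

theorem toralMap_one {d : ℕ} (x : UnitAddTorus (Fin d)) : toralMap 1 x = x := by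
  ext i
  simp [toralMap, Matrix.one_apply, ite_smul]

theorem toralMap_add_left {d : ℕ} (M N : Matrix (Fin d) (Fin d) ℤ) (x : UnitAddTorus (Fin d)) :
    toralMap (M + N) x = toralMap M x + toralMap N x := by
  ext i
  simp [toralMap, add_smul, Finset.sum_add_distrib]

theorem toralMap_smul_left {d : ℕ} (m : ℤ) (M : Matrix (Fin d) (Fin d) ℤ)
    (x : UnitAddTorus (Fin d)) : toralMap (m • M) x = toralMap M (m • x) := by
  ext i
  simp [toralMap, mul_smul, smul_comm m]

theorem toralMap_zsmul {d : ℕ} (m : ℤ) (M : Matrix (Fin d) (Fin d) ℤ)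
    (x : UnitAddTorus (Fin d)) : toralMap M (m • x) = m • toralMap M x := by
  ext i
  simp [toralMap, smul_comm _ m, Finset.smul_sum]

theorem toralMap_zero {d : ℕ} (M : Matrix (Fin d) (Fin d) ℤ) : toralMap M 0 = 0 := by
  ext i
  simp [toralMap]

theorem toralMap_mul {d : ℕ} (M N : Matrix (Fin d) (Fin d) ℤ) (x : UnitAddTorus (Fin d)) :
    toralMap (M * N) x = toralMap M (toralMap N x) := by
  ext i
  simp only [toralMap, mul_apply, Finset.sum_smul, Finset.smul_sum, mul_smul]
  rw [Finset.sum_comm]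

/-- A Borel section of `proj`. -/
theorem exists_measurable_rightInverse_proj (d : ℕ) :
    ∃ s : UnitAddTorus (Fin d) → Fin d → ℝ, Measurable s ∧ ∀ x, proj (s x) = x := by
  let e := AddCircle.measurableEquivIco (1 : ℝ) 0
  refine ⟨fun x i => (e (x i) : ℝ), ?_, fun x => ?_⟩
  · exact measurable_pi_lambda _ fun i =>
      measurable_subtype_coe.comp (e.measurable.comp (measurable_pi_apply i))
  · ext i
    exact e.symm_apply_apply (x i)

theorem map_cast_pow_sub_one {d : ℕ} (A : Matrix (Fin d) (Fin d) ℤ) (n : ℕ) :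
    (A ^ n - 1).map (Int.cast : ℤ → ℝ) = A.map (Int.cast : ℤ → ℝ) ^ n - 1 := by
  have := map_sub (Int.castRingHom ℝ).mapMatrix (A ^ n) 1
  rwa [map_pow, map_one] at this

theorem map_cast_pow {d : ℕ} (A : Matrix (Fin d) (Fin d) ℤ) (n : ℕ) :
    (A ^ n).map (Int.cast : ℤ → ℝ) = A.map (Int.cast : ℤ → ℝ) ^ n :=
  map_pow (Int.castRingHom ℝ).mapMatrix A n

theorem mulVec_intCast {d : ℕ} (M : Matrix (Fin d) (Fin d) ℤ) (z : Fin d → ℤ) :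
    M.map (Int.cast : ℤ → ℝ) *ᵥ (fun i => (z i : ℝ)) = fun i => ((M *ᵥ z) i : ℝ) := by
  ext i
  exact ((Int.castRingHom ℝ).map_mulVec M z i).symm

/-! ### Shadowing by periodic torsion points -/

/-- A nonzero integer vector killed by `A ^ n - 1` would make the right side of the orbit estimate
vanish, while its `l = 0` term does not. -/
theorem det_pow_sub_one_ne_zero {d : ℕ} {A : Matrix (Fin d) (Fin d) ℤ} {C : ℝ} {n : ℕ}
    (hn : 0 < n)
    (hC : ∀ w : Fin d → ℝ, ∑ l ∈ range n, ‖(A.map (Int.cast : ℤ → ℝ)) ^ l *ᵥ w‖ ≤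
      C * ‖((A.map (Int.cast : ℤ → ℝ)) ^ n - 1) *ᵥ w‖) :
    (A ^ n - 1).det ≠ 0 := by
  intro h
  obtain ⟨z, hz, hz0⟩ := Matrix.exists_mulVec_eq_zero_iff.2 h
  have h1 := hC fun i => (z i : ℝ)
  rw [← map_cast_pow_sub_one, mulVec_intCast, hz0] at h1
  have h2 : ‖(fun _ : Fin d => (0 : ℝ))‖ = 0 := norm_zero
  simp only [Pi.zero_apply, Int.cast_zero, h2, mul_zero] at h1
  have h3 := (Finset.single_le_sum (fun l _ => norm_nonneg _) (mem_range.2 hn)).trans h1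
  rw [pow_zero, one_mulVec, norm_le_zero_iff] at h3
  exact hz (funext fun i => Int.cast_injective (α := ℝ) (by simpa using congrFun h3 i))

theorem one_le_norm_intCast {d : ℕ} {z : Fin d → ℤ} (hz : z ≠ 0) :
    1 ≤ ‖(fun i => (z i : ℝ))‖ := by
  obtain ⟨i, hi⟩ := Function.ne_iff.1 hz
  refine le_trans ?_ (norm_le_pi_norm _ i)
  rw [Real.norm_eq_abs]
  exact_mod_cast Int.one_le_abs hi

/-- Every point `x` of the torus is shadowed, on average over a time interval of length `n`, by many
distinct points `y k x` fixed by `A ^ n` and killed by `m`, where `det (A ^ n - 1) = a * m`. -/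
theorem exists_periodic_shadowing {d : ℕ} {A : Matrix (Fin d) (Fin d) ℤ} (hA : A.det ≠ 0) {C : ℝ}
    (hC0 : 0 ≤ C) {n : ℕ} (hn : 0 < n)
    (hC : ∀ w : Fin d → ℝ, ∑ l ∈ range n, ‖(A.map (Int.cast : ℤ → ℝ)) ^ l *ᵥ w‖ ≤
      C * ‖((A.map (Int.cast : ℤ → ℝ)) ^ n - 1) *ᵥ w‖)
    {a m : ℤ} (hdet : (A ^ n - 1).det = a * m) (i₀ : Fin d) :
    ∃ y : ℕ → UnitAddTorus (Fin d) → UnitAddTorus (Fin d),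
      (∀ k, Measurable (y k)) ∧
      (∀ k x, toralMap (A ^ n) (y k x) = y k x) ∧
      (∀ k x, m • y k x = 0) ∧
      (∀ k x, ∑ l ∈ range n, dist (toralMap (A ^ l) (y k x)) (toralMap (A ^ l) x) ≤
        C * (|a| * (1 + k))) ∧
      (∀ (K : ℕ) x, C * (|a| * K) < n → Set.InjOn (fun k => y k x) (Set.Iio K)) := by
  have hne := det_pow_sub_one_ne_zero hn hC
  have ha : a ≠ 0 := fun h => hne (by rw [hdet, h, zero_mul])
  have haR : (a : ℝ) ≠ 0 := by exact_mod_cast ha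
  set AR := A.map (Int.cast : ℤ → ℝ) with hAR
  set L := AR ^ n - 1 with hL
  have hLmap : (A ^ n - 1).map (Int.cast : ℤ → ℝ) = L := map_cast_pow_sub_one A n
  have hLdet : IsUnit L.det := by
    have : L.det = (((A ^ n - 1).det : ℤ) : ℝ) := by
      rw [← hLmap]; exact ((Int.castRingHom ℝ).map_det (A ^ n - 1)).symm
    rw [this, isUnit_iff_ne_zero]
    exact_mod_cast hne
  have hLS : L * L⁻¹ = 1 := mul_nonsing_inv _ hLdet
  obtain ⟨s, hs, hsx⟩ := exists_measurable_rightInverse_proj d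
  -- The shadowing point is the image of `s x - w k x`, where `w` is chosen so that `L (s x - w)` is
  -- `a` times the integer vector `⌊a⁻¹ L (s x)⌋ + k e_{i₀}`. The shift by `k` yields the distinct
  -- points.
  let v : UnitAddTorus (Fin d) → Fin d → ℝ := fun x i => Int.fract (((a : ℝ)⁻¹ • L *ᵥ s x) i)
  let e : ℕ → Fin d → ℝ := fun k => Pi.single i₀ (k : ℝ)
  let w : ℕ → UnitAddTorus (Fin d) → Fin d → ℝ := fun k x => (a : ℝ) • L⁻¹ *ᵥ (v x - e k)
  have hLw : ∀ k x, L *ᵥ w k x = (a : ℝ) • (v x - e k) := by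
    intro k x
    simp only [w]
    rw [mulVec_smul, mulVec_mulVec, hLS, one_mulVec]
  have hLy : ∀ k x, ∃ z : Fin d → ℤ, L *ᵥ (s x - w k x) = (a : ℝ) • fun i => (z i : ℝ) := by
    intro k x
    refine ⟨fun i => ⌊((a : ℝ)⁻¹ • L *ᵥ s x) i⌋ + (Pi.single i₀ (k : ℤ) : Fin d → ℤ) i, ?_⟩
    rw [mulVec_sub, hLw]
    ext i
    have h1 : ((Pi.single i₀ (k : ℤ) : Fin d → ℤ) i : ℝ) = e k i := by
      simp only [e, Pi.single_apply]; split <;> simp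
    have h2 : (L *ᵥ s x) i = (a : ℝ) * ((a : ℝ)⁻¹ • L *ᵥ s x) i := by
      simp [haR]
    have h3 : v x i = ((a : ℝ)⁻¹ • L *ᵥ s x) i - ⌊((a : ℝ)⁻¹ • L *ᵥ s x) i⌋ :=
      (Int.self_sub_floor _).symm
    rw [Pi.sub_apply, h2, Pi.smul_apply (a : ℝ) (v x - e k), Pi.sub_apply, h3,
      Pi.smul_apply (a : ℝ) (fun _ => _), Int.cast_add, h1, smul_eq_mul, smul_eq_mul]
    ring
  have hwnorm : ∀ k x, ‖L *ᵥ w k x‖ ≤ |a| * (1 + k) := by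
    intro k x
    rw [hLw, norm_smul, Real.norm_eq_abs, Int.cast_abs]
    gcongr
    refine (norm_sub_le _ _).trans (add_le_add ?_ ?_)
    · rw [pi_norm_le_iff_of_nonneg zero_le_one]
      intro i
      rw [Real.norm_eq_abs, abs_of_nonneg (Int.fract_nonneg _)]
      exact (Int.fract_lt_one _).le
    · simp [e, Pi.norm_single]
  refine ⟨fun k x => proj (s x - w k x), fun k => ?_, fun k x => ?_, fun k x => ?_, fun k x => ?_,
    fun K x hK k hk k' hk' hkk' => ?_⟩
  · refine measurable_proj.comp (hs.sub ?_)
    have hmul : ∀ M : Matrix (Fin d) (Fin d) ℝ, Measurable fun v : Fin d → ℝ => M *ᵥ v :=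
      fun M => (Continuous.matrix_mulVec continuous_const continuous_id).measurable
    have hv : Measurable v := measurable_pi_lambda _ fun i =>
      measurable_fract.comp ((measurable_pi_apply i).comp (((hmul L).comp hs).const_smul (a : ℝ)⁻¹))
    exact ((hmul L⁻¹).comp (hv.sub_const _)).const_smul (a : ℝ)
  · obtain ⟨z, hz⟩ := hLy k x
    rw [toralMap_proj, map_cast_pow, ← sub_eq_zero, ← proj_sub, proj_eq_zero_iff]
    refine ⟨fun i => a * z i, ?_⟩
    rw [hL, sub_mulVec, one_mulVec] at hz
    rw [hz]
    ext i
    simp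
  · obtain ⟨z, hz⟩ := hLy k x
    -- Multiplying by the adjugate replaces `L` by its determinant `a * m`; cancelling `a` shows
    -- that `m (s x - w)` is an integer vector.
    have h1 : L.adjugate *ᵥ (L *ᵥ (s x - w k x)) = (a : ℝ) • ((m : ℝ) • (s x - w k x)) := by
      rw [mulVec_mulVec, adjugate_mul, smul_mulVec, one_mulVec, smul_smul, ← Int.cast_mul, ← hdet,
        ← hLmap]
      congr 1
      exact ((Int.castRingHom ℝ).map_det (A ^ n - 1)).symm
    have h2 : L.adjugate = ((A ^ n - 1).adjugate).map (Int.cast : ℤ → ℝ) := by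
      rw [← hLmap]
      exact ((Int.castRingHom ℝ).map_adjugate (A ^ n - 1)).symm
    rw [hz, mulVec_smul, h2, mulVec_intCast] at h1
    have h3 := smul_right_injective _ haR h1
    have h4 : m • proj (s x - w k x) = proj ((m : ℝ) • (s x - w k x)) := by
      ext i
      simp only [proj, Pi.smul_apply]
      rw [← AddCircle.coe_zsmul, zsmul_eq_mul, smul_eq_mul]
    rw [h4, proj_eq_zero_iff]
    exact ⟨_, h3.symm⟩
  · calc ∑ l ∈ range n, dist (toralMap (A ^ l) (proj (s x - w k x))) (toralMap (A ^ l) x)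
        ≤ ∑ l ∈ range n, ‖AR ^ l *ᵥ w k x‖ := by
          refine Finset.sum_le_sum fun l _ => ?_
          have hx : toralMap (A ^ l) x = proj (AR ^ l *ᵥ s x) := by
            rw [← map_cast_pow, ← toralMap_proj, hsx]
          rw [hx, toralMap_proj, map_cast_pow]
          refine (dist_proj_le _ _).trans (le_of_eq ?_)
          rw [← mulVec_sub, sub_sub_cancel_left, mulVec_neg, norm_neg]
      _ ≤ C * ‖L *ᵥ w k x‖ := hC _
      _ ≤ _ := by gcongr; exact hwnorm k x
  -- If two points coincide, the difference of the two `w`'s is a nonzero integer vector `z`. Each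
  -- `A ^ l z` is then integral and nonzero, so its orbit has length at least `n`, whereas the orbit
  -- estimate bounds it by `C * |a| * K < n`.
  · by_contra hne'
    simp only at hkk'
    rw [← sub_eq_zero, ← proj_sub, proj_eq_zero_iff, sub_sub_sub_cancel_left] at hkk'
    obtain ⟨z, hz⟩ := hkk'
    have hLz : L *ᵥ (fun i => (z i : ℝ)) = (a : ℝ) • (e k - e k') := by
      rw [← hz, mulVec_sub, hLw, hLw, ← smul_sub, sub_sub_sub_cancel_left]
    have hee : e k - e k' = Pi.single i₀ ((k : ℝ) - k') := (Pi.single_sub i₀ _ _).symm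
    have hz0 : z ≠ 0 := by
      rintro rfl
      have h1 : (fun i => (((0 : Fin d → ℤ) i : ℤ) : ℝ)) = (0 : Fin d → ℝ) := by ext; simp
      rw [h1, mulVec_zero, hee] at hLz
      have h2 := congrFun hLz i₀
      simp [haR, sub_eq_zero] at h2
      exact hne' h2
    have hpow : ∀ l : ℕ, (A ^ l) *ᵥ z ≠ 0 := fun l h =>
      hz0 (Matrix.eq_zero_of_mulVec_eq_zero (by rw [det_pow]; exact pow_ne_zero _ hA) h)
    have h3 : (n : ℝ) ≤ ∑ l ∈ range n, ‖AR ^ l *ᵥ (fun i => (z i : ℝ))‖ := by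
      calc (n : ℝ) = ∑ l ∈ range n, (1 : ℝ) := by simp
        _ ≤ _ := Finset.sum_le_sum fun l _ => by
          rw [← map_cast_pow, mulVec_intCast]
          exact one_le_norm_intCast (hpow l)
    have h4 : ‖L *ᵥ (fun i => (z i : ℝ))‖ ≤ |a| * K := by
      rw [hLz, norm_smul, hee, Pi.norm_single, Real.norm_eq_abs, Real.norm_eq_abs, Int.cast_abs]
      gcongr
      have hk1 : (k : ℝ) < K := by exact_mod_cast hk
      have hk2 : (k' : ℝ) < K := by exact_mod_cast hk'
      rw [abs_le]
      constructor <;> linarith [Nat.cast_nonneg (α := ℝ) k, Nat.cast_nonneg (α := ℝ) k']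
    have h5 := h3.trans ((hC _).trans (mul_le_mul_of_nonneg_left h4 hC0))
    linarith

/-! ### Orbit averages of an invariant measure -/

theorem measurable_toralMap {d : ℕ} (A : Matrix (Fin d) (Fin d) ℤ) : Measurable (toralMap A) :=
  (continuous_toralMap A).measurable

theorem map_toralMap_pow_of_mem {d : ℕ} {A : Matrix (Fin d) (Fin d) ℤ}
    {μ : ProbabilityMeasure (UnitAddTorus (Fin d))} (hμ : μ ∈ invariantMeasures A) (l : ℕ) :
    (μ : Measure (UnitAddTorus (Fin d))).map (toralMap (A ^ l)) = μ := by
  have h1 : (μ : Measure (UnitAddTorus (Fin d))).map (toralMap A) = μ :=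
    congrArg Subtype.val (show pushforward A μ = μ from hμ)
  induction l with
  | zero =>
    have : toralMap (A ^ 0) = id := funext fun x => by rw [pow_zero, toralMap_one, id]
    rw [this, Measure.map_id]
  | succ l ih =>
    have : toralMap (A ^ (l + 1)) = toralMap A ∘ toralMap (A ^ l) :=
      funext fun x => by rw [pow_succ', toralMap_mul, Function.comp]
    rw [this, ← Measure.map_map (measurable_toralMap A) (measurable_toralMap _), ih, h1]

/-- The average of the images of `μ` under the maps `A ^ l ∘ y k`, for `l < n` and `k < K`. -/
noncomputable def orbitAverage {d : ℕ} (A : Matrix (Fin d) (Fin d) ℤ)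
    (μ : Measure (UnitAddTorus (Fin d))) (y : ℕ → UnitAddTorus (Fin d) → UnitAddTorus (Fin d))
    (K n : ℕ) : Measure (UnitAddTorus (Fin d)) :=
  ((K * n : ℕ) : ℝ≥0∞)⁻¹ • ∑ k ∈ range K, ∑ l ∈ range n, μ.map fun x => toralMap (A ^ l) (y k x)

section orbitAverage

variable {d : ℕ} {A : Matrix (Fin d) (Fin d) ℤ} {μ : Measure (UnitAddTorus (Fin d))}
  {y : ℕ → UnitAddTorus (Fin d) → UnitAddTorus (Fin d)} {K n : ℕ}

theorem measurable_toralMap_comp (hy : ∀ k, Measurable (y k)) (k l : ℕ) :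
    Measurable fun x => toralMap (A ^ l) (y k x) :=
  (measurable_toralMap _).comp (hy k)

theorem orbitAverage_apply (hy : ∀ k, Measurable (y k)) {s : Set (UnitAddTorus (Fin d))}
    (hs : MeasurableSet s) :
    orbitAverage A μ y K n s = ((K * n : ℕ) : ℝ≥0∞)⁻¹ *
      ∑ k ∈ range K, ∑ l ∈ range n, μ {x | toralMap (A ^ l) (y k x) ∈ s} := by
  rw [orbitAverage, Measure.smul_apply, smul_eq_mul, Measure.finsetSum_apply]
  congr 1
  refine Finset.sum_congr rfl fun k _ => ?_
  rw [Measure.finsetSum_apply]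
  refine Finset.sum_congr rfl fun l _ => ?_
  rw [Measure.map_apply (measurable_toralMap_comp hy k l) hs]
  rfl

theorem isProbabilityMeasure_orbitAverage [IsProbabilityMeasure μ] (hy : ∀ k, Measurable (y k))
    (hK : 0 < K) (hn : 0 < n) : IsProbabilityMeasure (orbitAverage A μ y K n) := by
  constructor
  rw [orbitAverage_apply hy .univ]
  simp only [Set.mem_univ, Set.ofPred_true, measure_univ, Finset.sum_const, card_range, nsmul_eq_mul,
    mul_one]
  rw [← Nat.cast_mul]
  exact ENNReal.inv_mul_cancel (by simp [hK.ne', hn.ne']) (ENNReal.natCast_ne_top _)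

/-- Applying `A` shifts `l` by one, and the new term `l = n` equals the lost term `l = 0` because
each `y k x` is fixed by `A ^ n`. -/
theorem map_orbitAverage (hy : ∀ k, Measurable (y k))
    (hfix : ∀ k x, toralMap (A ^ n) (y k x) = y k x) :
    (orbitAverage A μ y K n).map (toralMap A) = orbitAverage A μ y K n := by
  ext s hs
  rw [Measure.map_apply (measurable_toralMap A) hs, orbitAverage_apply hy hs,
    orbitAverage_apply hy (measurable_toralMap A hs)]
  congr 1
  refine Finset.sum_congr rfl fun k _ => ?_
  have h1 : ∀ l x, toralMap (A ^ l) (y k x) ∈ toralMap A ⁻¹' s ↔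
      toralMap (A ^ (l + 1)) (y k x) ∈ s := by
    intro l x
    rw [pow_succ', toralMap_mul, Set.mem_preimage]
  simp only [h1]
  rcases n with _ | n
  · simp
  · rw [Finset.sum_range_succ, Finset.sum_range_succ']
    simp only [hfix, pow_zero, toralMap_one]

/-- For fixed `l < n` the map `A ^ l` is injective on the points `y k x`, as `A ^ (n - l)` undoes it
there. The events `A ^ l (y k x) = z` for `k < K` are therefore disjoint, and each `l` contributes
at most `1` out of `K * n`. -/
theorem orbitAverage_singleton_le [IsProbabilityMeasure μ] (hy : ∀ k, Measurable (y k)) (hn : 0 < n)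
    (hK : 0 < K) (hfix : ∀ k x, toralMap (A ^ n) (y k x) = y k x)
    (hinj : ∀ x, Set.InjOn (fun k => y k x) (Set.Iio K)) (z : UnitAddTorus (Fin d)) :
    orbitAverage A μ y K n {z} ≤ (K : ℝ≥0∞)⁻¹ := by
  rw [orbitAverage_apply hy (measurableSet_singleton z), Finset.sum_comm]
  have hle : ∀ l ∈ range n, ∑ k ∈ range K, μ {x | toralMap (A ^ l) (y k x) ∈ ({z} : Set _)} ≤ 1 := by
    intro l hl
    rw [← measure_biUnion_finset]
    · exact prob_le_one
    · intro k hk k' hk' hkk'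
      rw [Function.onFun, Set.disjoint_left]
      intro x hx hx'
      refine hkk' (hinj x (by simpa using hk) (by simpa using hk') ?_)
      have h1 : toralMap (A ^ l) (y k x) = toralMap (A ^ l) (y k' x) := by
        simp only [Set.mem_singleton_iff, Set.mem_ofPred_eq] at hx hx'
        rw [hx, hx']
      have h2 := congrArg (toralMap (A ^ (n - l))) h1
      rw [← toralMap_mul, ← toralMap_mul, ← pow_add,
        Nat.sub_add_cancel (mem_range.1 hl).le, hfix, hfix] at h2
      exact h2
    · exact fun k _ => measurable_toralMap_comp hy k l (measurableSet_singleton z)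
  calc ((K * n : ℕ) : ℝ≥0∞)⁻¹ * _ ≤ ((K * n : ℕ) : ℝ≥0∞)⁻¹ * ∑ l ∈ range n, 1 := by
        gcongr with l hl
        exact hle l hl
    _ = (K : ℝ≥0∞)⁻¹ := by
        have hn' : (n : ℝ≥0∞) ≠ 0 := by simp [hn.ne']
        rw [Finset.sum_const, card_range, nsmul_eq_mul, mul_one, Nat.cast_mul,
          ENNReal.mul_inv (by simp [hK.ne']) (by simp), mul_assoc,
          ENNReal.inv_mul_cancel hn' (ENNReal.natCast_ne_top _), mul_one]

theorem ae_orbitAverage (hy : ∀ k, Measurable (y k)) {m : ℤ} (hm : ∀ k x, m • y k x = 0) :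
    ∀ᵐ x ∂orbitAverage A μ y K n, m • x = 0 := by
  have hcl : MeasurableSet {x : UnitAddTorus (Fin d) | m • x = 0}ᶜ :=
    (isClosed_eq (continuous_zsmul m) continuous_const).measurableSet.compl
  rw [ae_iff]
  change orbitAverage A μ y K n {x | m • x = 0}ᶜ = 0
  rw [orbitAverage_apply hy hcl]
  simp [← toralMap_zsmul, hm, toralMap_zero]

/-- Invariance turns `∫ f dμ` into the average over `l < n` of `∫ f (A ^ l x) dμ`. The two averages
are then compared along each orbit segment, whose total deviation is at most `D`. -/
theorem abs_integral_orbitAverage_sub_le {μ : ProbabilityMeasure (UnitAddTorus (Fin d))}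
    (hμ : μ ∈ invariantMeasures A) (hy : ∀ k, Measurable (y k)) (hK : 0 < K) (hn : 0 < n) {D : ℝ}
    (hD : ∀ k < K, ∀ x,
      ∑ l ∈ range n, dist (toralMap (A ^ l) (y k x)) (toralMap (A ^ l) x) ≤ D)
    {f : UnitAddTorus (Fin d) → ℝ} {c : ℝ≥0} (hf : LipschitzWith c f) :
    |∫ x, f x ∂orbitAverage A (μ : Measure _) y K n - ∫ x, f x ∂(μ : Measure _)| ≤ c * D / n := by
  have hfm : Measurable f := hf.continuous.measurable
  obtain ⟨b, hb⟩ := (isCompact_range hf.continuous).isBounded.exists_norm_le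
  have hint : ∀ (ν : Measure (UnitAddTorus (Fin d))) [IsFiniteMeasure ν] (g : UnitAddTorus (Fin d) →
      UnitAddTorus (Fin d)), Measurable g → Integrable (fun x => f (g x)) ν := fun ν _ g hg =>
    .of_bound (hfm.comp hg).aestronglyMeasurable b (.of_forall fun x => hb _ ⟨_, rfl⟩)
  have hm := measurable_toralMap_comp (A := A) hy
  have hprob : ∀ k l, IsProbabilityMeasure ((μ : Measure _).map fun x => toralMap (A ^ l) (y k x)) :=
    fun k l => Measure.isProbabilityMeasure_map (hm k l).aemeasurable
  have hid : ∀ k l, Integrable f ((μ : Measure _).map fun x => toralMap (A ^ l) (y k x)) :=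
    fun k l => hint _ id measurable_id
  have h1 : ∫ x, f x ∂orbitAverage A (μ : Measure _) y K n = ((K : ℝ) * n)⁻¹ *
      ∑ k ∈ range K, ∑ l ∈ range n, ∫ x, f (toralMap (A ^ l) (y k x)) ∂(μ : Measure _) := by
    rw [orbitAverage, integral_smul_measure, integral_finsetSum_measure
      fun k _ => integrable_finsetSum_measure.2 fun l _ => hid k l]
    simp only [ENNReal.toReal_inv, Nat.cast_mul, smul_eq_mul]
    congr 1
    refine Finset.sum_congr rfl fun k _ => ?_
    rw [integral_finsetSum_measure fun l _ => hid k l]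
    exact Finset.sum_congr rfl fun l _ =>
      integral_map (hm k l).aemeasurable hfm.aestronglyMeasurable
  have hKn : (0 : ℝ) < K * n := by positivity
  have h2 : ∫ x, f x ∂(μ : Measure _) = ((K : ℝ) * n)⁻¹ *
      ∑ k ∈ range K, ∑ l ∈ range n, ∫ x, f (toralMap (A ^ l) x) ∂(μ : Measure _) := by
    have h3 : ∀ l, ∫ x, f (toralMap (A ^ l) x) ∂(μ : Measure _) = ∫ x, f x ∂(μ : Measure _) := by
      intro l
      conv_rhs => rw [← map_toralMap_pow_of_mem hμ l]
      exact (integral_map (measurable_toralMap _).aemeasurable hfm.aestronglyMeasurable).symm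
    simp only [h3, Finset.sum_const, card_range, nsmul_eq_mul]
    field_simp
  have h4 : ∀ k < K, |∑ l ∈ range n, ∫ x, f (toralMap (A ^ l) (y k x)) ∂(μ : Measure _) -
      ∑ l ∈ range n, ∫ x, f (toralMap (A ^ l) x) ∂(μ : Measure _)| ≤ c * D := by
    intro k hk
    have i1 : ∀ l ∈ range n, Integrable (fun x => f (toralMap (A ^ l) (y k x))) (μ : Measure _) :=
      fun l _ => hint _ _ (hm k l)
    have i2 : ∀ l ∈ range n, Integrable (fun x => f (toralMap (A ^ l) x)) (μ : Measure _) :=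
      fun l _ => hint _ _ (measurable_toralMap _)
    rw [← integral_finsetSum _ i1, ← integral_finsetSum _ i2,
      ← integral_sub (integrable_finsetSum _ i1) (integrable_finsetSum _ i2), ← Real.norm_eq_abs]
    refine (norm_integral_le_of_norm_le_const (C := c * D) (.of_forall fun x => ?_)).trans (by simp)
    rw [← Finset.sum_sub_distrib]
    calc ‖∑ l ∈ range n, (f (toralMap (A ^ l) (y k x)) - f (toralMap (A ^ l) x))‖
        ≤ ∑ l ∈ range n, c * dist (toralMap (A ^ l) (y k x)) (toralMap (A ^ l) x) :=
          (norm_sum_le _ _).trans (Finset.sum_le_sum fun l _ => by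
            rw [← dist_eq_norm]; exact hf.dist_le_mul _ _)
      _ ≤ c * D := by
          rw [← Finset.mul_sum]
          exact mul_le_mul_of_nonneg_left (hD k hk x) c.coe_nonneg
  rw [h1, h2, ← mul_sub, ← Finset.sum_sub_distrib, abs_mul, abs_of_pos (inv_pos.2 hKn)]
  calc ((K : ℝ) * n)⁻¹ * _ ≤ ((K : ℝ) * n)⁻¹ * ∑ k ∈ range K, c * D := by
        gcongr
        exact (Finset.abs_sum_le_sum_abs _ _).trans
          (Finset.sum_le_sum fun k hk => h4 k (mem_range.1 hk))
    _ = c * D / n := by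
        rw [Finset.sum_const, card_range, nsmul_eq_mul]
        have : (K : ℝ) ≠ 0 := by positivity
        field_simp

end orbitAverage

/-! ### Open conditions in the weak-* topology -/

theorem isOpen_setOf_measure_closed_lt {X : Type*} [TopologicalSpace X] [MeasurableSpace X]
    [OpensMeasurableSpace X] [HasOuterApproxClosed X] {F : Set X} (hF : IsClosed F) (ε : ℝ≥0∞) :
    IsOpen {μ : ProbabilityMeasure X | (μ : Measure X) F < ε} := by
  rw [isOpen_iff_mem_nhds]
  intro μ hμ
  have h := ProbabilityMeasure.limsup_measure_closed_le_of_tendsto (L := 𝓝 μ)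
    (μs := fun ν => ν) tendsto_id hF
  exact eventually_lt_of_limsup_lt (h.trans_lt hμ)

/-- By compactness, finitely many closed balls of mass below `ε` cover the space; their masses stay
below `ε` for nearby measures, and every point lies in one of them. -/
theorem isOpen_setOf_forall_measure_singleton_lt {X : Type*} [MetricSpace X] [CompactSpace X]
    [MeasurableSpace X] [BorelSpace X] (ε : ℝ≥0∞) :
    IsOpen {μ : ProbabilityMeasure X | ∀ x, (μ : Measure X) {x} < ε} := by
  rw [isOpen_iff_mem_nhds]
  intro μ hμ
  have hF : ∀ x, ∃ r > 0, (μ : Measure X) (Metric.closedBall x r) < ε := by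
    intro x
    have h := tendsto_measure_cthickening_of_isClosed (μ := (μ : Measure X)) (s := {x})
      ⟨1, one_pos, measure_ne_top _ _⟩ isClosed_singleton
    obtain ⟨r, hr, h0⟩ := ((h.mono_left nhdsWithin_le_nhds).eventually_lt_const (hμ x) |>.and
      (self_mem_nhdsWithin (s := Set.Ioi (0 : ℝ)))).exists
    exact ⟨r, h0, by rwa [Metric.cthickening_singleton x (le_of_lt h0)] at hr⟩
  choose r hr hlt using hF
  obtain ⟨t, -, ht⟩ := isCompact_univ.elim_nhds_subcover (fun x => Metric.closedBall x (r x))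
    fun x _ => Metric.closedBall_mem_nhds x (hr x)
  have hmem : ⋂ x ∈ t, {ν : ProbabilityMeasure X | (ν : Measure X) (Metric.closedBall x (r x)) < ε} ∈
      𝓝 μ := (Filter.biInter_finset_mem t).2 fun x _ =>
    (isOpen_setOf_measure_closed_lt Metric.isClosed_closedBall ε).mem_nhds (hlt x)
  filter_upwards [hmem] with ν hν z
  obtain ⟨x, hx, hz⟩ := Set.mem_iUnion₂.1 (ht (Set.mem_univ z))
  exact (measure_mono (Set.singleton_subset_iff.2 hz)).trans_lt (Set.mem_iInter₂.1 hν x hx)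

/-! ### Density of torsion measures -/

/-- Invariant measures with small atoms, carried by a group of torsion points of order coprime
to `q`, are dense in the space of invariant measures. -/
theorem dense_invariantMeasures_torsion {d : ℕ} (i₀ : Fin d) {A : Matrix (Fin d) (Fin d) ℤ}
    (hA : A.det ≠ 0)
    (hdiag : ∃ (P : Matrix.GeneralLinearGroup (Fin d) ℂ) (eig : Fin d → ℂ),
      (∀ j, ‖eig j‖ ≠ 1) ∧
      A.map (Int.cast : ℤ → ℂ) =
        (P : Matrix (Fin d) (Fin d) ℂ) * Matrix.diagonal eig *
          ((P⁻¹ : Matrix.GeneralLinearGroup (Fin d) ℂ) : Matrix (Fin d) (Fin d) ℂ))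
    {q : ℤ} (hq : q ≠ 0) {K : ℕ} (hK : 0 < K) :
    Dense {ν : invariantMeasures A |
      (∀ x, ((ν : ProbabilityMeasure (UnitAddTorus (Fin d))) : Measure (UnitAddTorus (Fin d))) {x} ≤ (K : ℝ≥0∞)⁻¹) ∧
      ∃ m : ℤ, m ≠ 0 ∧ IsCoprime m q ∧
        ∀ᵐ x ∂((ν : ProbabilityMeasure (UnitAddTorus (Fin d))) : Measure (UnitAddTorus (Fin d))), m • x = 0} := by
  intro μ
  obtain ⟨C, hC0, hC⟩ := exists_sum_norm_pow_mulVec_le A hdiag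
  have hdet1 : (A - 1).det ≠ 0 := by
    simpa using det_pow_sub_one_ne_zero one_pos (hC 1)
  set a := (A - 1).det with ha
  obtain ⟨T, hT, hTm⟩ := exists_det_pow_sub_one_eq A hdet1 q hq
  let N : ℕ → ℕ := fun t => 1 + t * T
  have hN : Tendsto N atTop atTop := tendsto_atTop_mono (f := id) (fun t => by
    change t ≤ 1 + t * T; nlinarith) tendsto_id
  have hNR : Tendsto (fun t => (N t : ℝ)) atTop atTop := tendsto_natCast_atTop_atTop.comp hN
  have key : ∀ t, 0 < t → C * (|a| * K) < N t → ∃ ν : invariantMeasures A,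
      ((∀ x, ((ν : ProbabilityMeasure (UnitAddTorus (Fin d))) : Measure (UnitAddTorus (Fin d))) {x} ≤ (K : ℝ≥0∞)⁻¹) ∧
      ∃ m : ℤ, m ≠ 0 ∧ IsCoprime m q ∧
        ∀ᵐ x ∂((ν : ProbabilityMeasure (UnitAddTorus (Fin d))) : Measure (UnitAddTorus (Fin d))), m • x = 0) ∧
      ∀ (f : UnitAddTorus (Fin d) → ℝ) (c : ℝ≥0), LipschitzWith c f →
        |∫ x, f x ∂((ν : ProbabilityMeasure (UnitAddTorus (Fin d))) : Measure (UnitAddTorus (Fin d))) -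
          ∫ x, f x ∂((μ : ProbabilityMeasure (UnitAddTorus (Fin d))) : Measure (UnitAddTorus (Fin d)))| ≤
          c * (C * (|a| * (1 + K))) / N t := by
    intro t ht htK
    have hn : 0 < N t := by simp [N]
    obtain ⟨m, hm, hdet⟩ := hTm t ht
    have hm0 : m ≠ 0 := fun h =>
      det_pow_sub_one_ne_zero hn (hC (N t)) (by rw [hdet, h, mul_zero])
    obtain ⟨y, hy, hfix, htor, hdist, hinj⟩ := exists_periodic_shadowing hA hC0 hn (hC (N t)) hdet i₀
    have hp := isProbabilityMeasure_orbitAverage (A := A)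
      (μ := ((μ : ProbabilityMeasure (UnitAddTorus (Fin d))) : Measure (UnitAddTorus (Fin d)))) hy hK hn
    refine ⟨⟨⟨_, hp⟩, Subtype.ext (map_orbitAverage hy hfix)⟩,
      ⟨orbitAverage_singleton_le hy hn hK hfix fun x => hinj K x htK, m, hm0, hm,
        ae_orbitAverage hy htor⟩, fun f c hf => ?_⟩
    refine abs_integral_orbitAverage_sub_le μ.2 hy hK hn (fun k hk x => (hdist k x).trans ?_) hf
    gcongr
  have hev : ∀ᶠ t in atTop, 0 < t ∧ C * (|a| * K) < N t :=
    (eventually_gt_atTop 0).and (hNR.eventually_gt_atTop _)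
  have : Nonempty (invariantMeasures A) := ⟨μ⟩
  -- For the finitely many `t` that are too small, `μ` itself serves as a default value.
  have hchoose : ∀ t, ∃ ν : invariantMeasures A, 0 < t ∧ C * (|a| * K) < N t → _ := fun t => by
    by_cases h : 0 < t ∧ C * (|a| * K) < N t
    · exact (key t h.1 h.2).imp fun ν hν _ => hν
    · exact ⟨μ, fun h' => absurd h' h⟩
  choose ν hν using hchoose
  refine mem_closure_of_tendsto (f := ν) (b := atTop) ?_ (hev.mono fun t ht => (hν t ht).1)
  rw [tendsto_subtype_rng, tendsto_iff_forall_lipschitz_integral_tendsto]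
  rintro f - ⟨c, hf⟩
  rw [tendsto_iff_dist_tendsto_zero]
  refine squeeze_zero' (.of_forall fun _ => dist_nonneg)
    (hev.mono fun t ht => (Real.dist_eq _ _).trans_le ((hν t ht).2 f c hf)) ?_
  exact hNR.const_div_atTop _

/-! ### Torsion measures: invariance and singularity -/

/-- On `m`-torsion points the term `m • D` acts as zero, so `T_M` is almost everywhere the identity.
-/
theorem pushforward_eq_self_of_torsion {d : ℕ} {M D : Matrix (Fin d) (Fin d) ℤ} {m : ℤ}
    (hM : M = 1 + m • D) {ν : ProbabilityMeasure (UnitAddTorus (Fin d))}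
    (hν : ∀ᵐ x ∂(ν : Measure (UnitAddTorus (Fin d))), m • x = 0) : pushforward M ν = ν := by
  refine Subtype.ext ?_
  change (ν : Measure (UnitAddTorus (Fin d))).map (toralMap M) = ν
  have h : toralMap M =ᵐ[(ν : Measure (UnitAddTorus (Fin d)))] id := by
    filter_upwards [hν] with x hx
    rw [hM, toralMap_add_left, toralMap_one, toralMap_smul_left, hx, toralMap_zero, add_zero, id]
  rw [Measure.map_congr h, Measure.map_id]

/-- The torus has only finitely many `m`-torsion points, and a finite set is Lebesgue null. -/
theorem ne_lebesgue_of_torsion {d : ℕ} (i₀ : Fin d) {m : ℤ} (hm : m ≠ 0)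
    {ν : ProbabilityMeasure (UnitAddTorus (Fin d))}
    (hν : ∀ᵐ x ∂(ν : Measure (UnitAddTorus (Fin d))), m • x = 0) : ν ≠ lebesgue d := by
  rintro rfl
  have : Nonempty (Fin d) := ⟨i₀⟩
  have hnull : NullSingletonClass (volume : Measure UnitAddCircle) := ⟨fun x => by
    rw [← Metric.closedBall_zero, AddCircle.volume_closedBall]; simp⟩
  have hfin : {x : UnitAddTorus (Fin d) | m • x = 0}.Finite := by
    have h1 : {u : UnitAddCircle | m • u = 0}.Finite := by
      refine (AddCircle.finite_torsion (1 : ℝ) (Int.natAbs_pos.2 hm)).subset fun u hu => ?_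
      rw [Set.mem_ofPred_eq] at hu ⊢
      rcases Int.natAbs_eq m with h | h <;> rw [h] at hu <;> simpa using hu
    refine (Set.Finite.pi' fun _ : Fin d => h1).subset fun x hx i => ?_
    exact congrFun hx i
  have h0 : volume {x : UnitAddTorus (Fin d) | m • x = 0} = 0 := hfin.measure_zero _
  have h1 : volume {x : UnitAddTorus (Fin d) | m • x = 0}ᶜ = 0 := hν
  have hp := isProbabilityMeasure_volume d
  have h2 := measure_univ (μ := (volume : Measure (UnitAddTorus (Fin d))))
  rw [← Set.union_compl_self {x : UnitAddTorus (Fin d) | m • x = 0}] at h2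
  have h3 := (measure_union_le (μ := (volume : Measure (UnitAddTorus (Fin d))))
    {x : UnitAddTorus (Fin d) | m • x = 0} {x : UnitAddTorus (Fin d) | m • x = 0}ᶜ)
  rw [h2, h0, h1, add_zero] at h3
  simp at h3

theorem continuous_pushforward {d : ℕ} (M : Matrix (Fin d) (Fin d) ℤ) :
    Continuous (pushforward M) :=
  ProbabilityMeasure.continuous_map (continuous_toralMap M)

end ToralDynamics

open ToralDynamics

/-! ### Baire category argument -/

theorem theorem3 (d : ℕ) (hd : 2 ≤ d) (A B : Matrix (Fin d) (Fin d) ℤ)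
    (hA : A.det ≠ 0) (hB : B.det ≠ 0)
    (hdiag : ∃ (P : Matrix.GeneralLinearGroup (Fin d) ℂ) (eig : Fin d → ℂ),
      (∀ j, ‖eig j‖ ≠ 1) ∧
      A.map (Int.cast : ℤ → ℂ) =
        (P : Matrix (Fin d) (Fin d) ℂ) * Matrix.diagonal eig *
          ((P⁻¹ : Matrix.GeneralLinearGroup (Fin d) ℂ) : Matrix (Fin d) (Fin d) ℂ))
    (hAB : IsCoprime A.det B.det ∨
      ((∀ i j, j < i → A i j = 0) ∨ (∀ i j, i < j → A i j = 0))) :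
    {μ : ToralDynamics.invariantMeasures A |
        NullSingletonClass ((μ : ProbabilityMeasure (UnitAddTorus (Fin d))) :
          Measure (UnitAddTorus (Fin d))) ∧
        ¬ Tendsto (fun n : ℕ => ToralDynamics.pushforward (B ^ n) (μ : ProbabilityMeasure _))
            atTop (𝓝 (ToralDynamics.lebesgue d))} ∈
      residual (ToralDynamics.invariantMeasures A) := by
  let _ : MetricSpace (ProbabilityMeasure (UnitAddTorus (Fin d))) :=
    TopologicalSpace.metrizableSpaceMetric _
  let i₀ : Fin d := ⟨0, by omega⟩
  have hdense := fun K hK => dense_invariantMeasures_torsion i₀ hA hdiag hB (K := K) hK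
  have hatoms : ∀ K : ℕ, ∀ᶠ μ : invariantMeasures A in residual _, ∀ x,
      ((μ : ProbabilityMeasure (UnitAddTorus (Fin d))) : Measure (UnitAddTorus (Fin d))) {x} <
        ((K + 1 : ℕ) : ENNReal)⁻¹ := fun K =>
    residual_of_dense_open
      ((isOpen_setOf_forall_measure_singleton_lt _).preimage continuous_subtype_val)
      -- Atoms of mass at most `1 / (K + 2)` give the strict bound by `1 / (K + 1)` that openness
      -- requires.
      ((hdense (K + 2) (by omega)).mono fun μ hμ x => (hμ.1 x).trans_lt
        (ENNReal.inv_lt_inv.2 (by exact_mod_cast Nat.lt_succ_self _)))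
  have hleb : ∀ᶠ μ : invariantMeasures A in residual _,
      (μ : ProbabilityMeasure (UnitAddTorus (Fin d))) ≠ lebesgue d :=
    residual_of_dense_open (isOpen_ne.preimage continuous_subtype_val)
      ((hdense 1 one_pos).mono fun μ hμ => by
        obtain ⟨_, m, hm, _, hμ⟩ := hμ
        exact ne_lebesgue_of_torsion i₀ hm hμ)
  -- Approximate return at some time `n ≥ j` is an open condition. Torsion measures satisfy it
  -- exactly, at the time `j * r`.
  have hrec : ∀ j : ℕ, ∀ᶠ μ : invariantMeasures A in residual _, ∃ n ≥ j,
      dist (pushforward (B ^ n) (μ : ProbabilityMeasure _)) μ < 1 / ((j : ℝ) + 1) := by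
    intro j
    refine residual_of_dense_open ?_ ((hdense 1 one_pos).mono ?_)
    · simp only [Set.ofPred_exists, Set.ofPred_and]
      refine isOpen_iUnion fun n => isOpen_const.inter (isOpen_lt ?_ continuous_const)
      exact ((continuous_pushforward _).comp continuous_subtype_val).dist continuous_subtype_val
    · rintro μ ⟨_, m, hm, hmB, hμ⟩
      obtain ⟨r, hr, hpow⟩ := exists_pow_eq_one_add_smul B m hm hmB
      obtain ⟨D, hD⟩ := hpow j
      refine ⟨j * r, Nat.le_mul_of_pos_right j hr, ?_⟩
      rw [pushforward_eq_self_of_torsion hD hμ, dist_self]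
      positivity
  filter_upwards [eventually_countable_forall.2 hatoms, hleb, eventually_countable_forall.2 hrec]
    with μ h1 h2 h3
  refine ⟨⟨fun x => ?_⟩, fun hlim => h2 ?_⟩
  · by_contra h
    obtain ⟨K, hK⟩ := ENNReal.exists_inv_nat_lt h
    exact lt_irrefl _ ((h1 K x).trans_le ((ENNReal.inv_le_inv.2 (by
      exact_mod_cast Nat.le_succ K)).trans hK.le))
  -- The return times tend to infinity and the images along them converge to `μ`, so a Lebesgue
  -- limit would force `μ` to be Lebesgue measure.
  · choose n hn hdist using h3
    have h4 := hlim.comp (tendsto_atTop_mono hn tendsto_id)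
    have h5 : Tendsto (fun j => pushforward (B ^ n j) (μ : ProbabilityMeasure _)) atTop
        (𝓝 (μ : ProbabilityMeasure (UnitAddTorus (Fin d)))) := by
      rw [tendsto_iff_dist_tendsto_zero]
      exact squeeze_zero (fun _ => dist_nonneg) (fun j => (hdist j).le)
        tendsto_one_div_add_atTop_nhds_zero_nat
    exact tendsto_nhds_unique h5 h4
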